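/- Let $\mathsf H$ be a quaternionic Hilbert space, i.e. a right $\mathbb H$-module with an $\mathbb H$-valued scalar product $\langle\cdot|\cdot\rangle$ that is right-linear in the second entry, Hermitian and positive definite, complete for the norm $\|x\|=\sqrt{\langle x|x\rangle}$. For a bounded right-linear operator $T$ on $\mathsf H$ let $T^*$ be its adjoint, let $|T|=\sqrt{T^*T}$ be the unique positive self-adjoint square root of $T^*T$, and call $T$ of trace class if $\sum_{u\in N}\langle u|\,|T|u\rangle<+\infty$ for some Hilbert basis $N$ of $\mathsf H$. For a Hilbert basis $N$ put $\mathrm{tr}_N(T)=\sum_{u\in N}\langle u|Tu\rangle$. Let $\mathrm{tr}^{\mathbb R}(T)$ denote the common value of $\mathrm{Re}(\mathrm{tr}_N(T))$ over all Hilbert bases $N$, and let $\mathrm{tr}(T)$ denote the common value of $\mathrm{tr}_N(T)$ over all Hilbert bases $N$ if $\mathrm{tr}_N(T)$ does not depend on $N$. Let $A$ be a bounded right-linear operator of trace class on $\mathsf H$, let $J$ be a bounded right-linear operator on $\mathsf H$ with $J=-J^*$, $JJ=-I$ and $A-A^*=J|A-A^*|$, and let $\imath\in\mathbb H$ with $|\imath|=1$.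 For an operator $K$ write $\mathsf H_{K\imath}=\{z\in\mathsf H : Kz=z\imath\}$. For every Hilbert basis $M$ of $\mathsf H$ the series defining $\mathrm{tr}_M(A)$ and $\mathrm{tr}_M(|A-A^*|)$ converge absolutely, and $\mathrm{Re}(\mathrm{tr}_M(A))$ and $\mathrm{tr}_M(|A-A^*|)$ do not depend on $M$, so that $\mathrm{tr}^{\mathbb R}(A)$ and $\mathrm{tr}(|A-A^*|)$ are well defined. Moreover, for every Hilbert basis $N$ of $\mathsf H$ with $N\subset\mathsf H_{J\imath}$, $$\mathrm{tr}_N(A)=\mathrm{tr}^{\mathbb R}(A)+\frac{\imath}{2}\,\mathrm{tr}(|A-A^*|).$$ If $J'$ is a bounded right-linear operator with $J'x=Jx$ for all $x\in\mathrm{Ker}(A-A^*)^\perp$, then the same identity holds with $N'$ in place of $N$ for every Hilbert basis $N'$ of $\mathsf H$ with $N'\subset\mathsf H_{J'\imath}$. -/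

import Mathlib

open scoped Quaternion
open MulOpposite (op)

/-- A quaternionic inner product on a right quaternionic vector space `H`. Right multiplication of
a vector `x` by a quaternion `q` is written `op q • x`. The scalar product `qinner x y` is additive
and right-linear in its second entry, Hermitian, positive, and it induces the norm of `H`;
the last two requirements are contained in `⟨x|x⟩ = ‖x‖²`. Together with `CompleteSpace H` this is
a quaternionic Hilbert space. -/
class QuaternionicInnerProductSpace (H : Type*) [NormedAddCommGroup H] [Module ℍ[ℝ]ᵐᵒᵖ H] where
  /-- the scalar product `⟨x|y⟩` -/
  qinner : H → H → ℍ[ℝ]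
  qinner_add_right : ∀ x y z, qinner x (y + z) = qinner x y + qinner x z
  qinner_smul_right : ∀ x y q, qinner x (op q • y) = qinner x y * q
  star_qinner : ∀ x y, star (qinner x y) = qinner y x
  qinner_self : ∀ x, qinner x x = ((‖x‖ ^ 2 : ℝ) : ℍ[ℝ])

namespace Quaternionic

open QuaternionicInnerProductSpace

section Basic

variable {H : Type*} [NormedAddCommGroup H] [Module ℍ[ℝ]ᵐᵒᵖ H] [QuaternionicInnerProductSpace H]

theorem qinner_add_left (x y z : H) : qinner (x + y) z = qinner x z + qinner y z := by
  rw [← star_qinner, qinner_add_right, star_add, star_qinner, star_qinner]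

theorem qinner_smul_left (x y : H) (q : ℍ[ℝ]) : qinner (op q • x) y = star q * qinner x y := by
  rw [← star_qinner, qinner_smul_right, star_mul, star_qinner]

theorem qinner_sub_left (x y z : H) : qinner (x - y) z = qinner x z - qinner y z := by
  have h := qinner_add_left (x - y) y z
  rw [sub_add_cancel] at h
  rw [h, add_sub_cancel_right]

theorem ext_qinner {x y : H} (h : ∀ z, qinner x z = qinner y z) : x = y := by
  have h1 : qinner (x - y) (x - y) = 0 := by rw [qinner_sub_left, h, sub_self]
  rw [qinner_self, ← Quaternion.coe_zero, Quaternion.coe_inj] at h1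
  exact sub_eq_zero.1 (norm_eq_zero.1 (pow_eq_zero_iff two_ne_zero |>.1 h1))

theorem norm_op_smul (x : H) (q : ℍ[ℝ]) : ‖op q • x‖ = ‖q‖ * ‖x‖ := by
  have h : qinner (op q • x) (op q • x) = ((‖q‖ * ‖x‖) ^ 2 : ℝ) := by
    rw [qinner_smul_right, qinner_smul_left, qinner_self, mul_assoc, Quaternion.coe_commutes,
      ← mul_assoc, Quaternion.star_mul_self, Quaternion.normSq_eq_norm_mul_self,
      ← Quaternion.coe_mul]
    congr 1; ring
  rw [qinner_self, Quaternion.coe_inj] at h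
  exact (pow_left_inj₀ (norm_nonneg _) (by positivity) two_ne_zero).1 h

/-- The complex part `a + b i` of the quaternion `a + b i + c j + d k`. -/
def cpart (q : ℍ[ℝ]) : ℂ := ⟨q.re, q.imI⟩

/-- The imaginary unit `j`. -/
def unitJ : ℍ[ℝ] := ⟨0, 0, 1, 0⟩

@[simp] theorem unitJ_re : unitJ.re = 0 := rfl

@[simp] theorem unitJ_imI : unitJ.imI = 0 := rfl

@[simp] theorem unitJ_imJ : unitJ.imJ = 1 := rfl

@[simp] theorem unitJ_imK : unitJ.imK = 0 := rfl

theorem cpart_ext {p q : ℍ[ℝ]} (h : cpart p = cpart q)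
    (h' : cpart (p * unitJ) = cpart (q * unitJ)) : p = q := by
  simp [cpart, Complex.ext_iff] at h h'
  exact Quaternion.ext _ _ h.1 h.2 h'.1 h'.2

/-- A quaternionic Hilbert space as a complex one: complex scalars act through `ℂ ⊆ ℍ`, and the
complex scalar product is the complex part of the quaternionic one. -/
@[reducible] noncomputable def toComplex : InnerProductSpace ℂ H where
  smul z x := op (z : ℍ[ℝ]) • x
  one_smul x := by
    change op ((1 : ℂ) : ℍ[ℝ]) • x = x
    simp
  mul_smul z w x := by
    change op ((z * w : ℂ) : ℍ[ℝ]) • x = op (z : ℍ[ℝ]) • op (w : ℍ[ℝ]) • x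
    rw [smul_smul, ← MulOpposite.op_mul, mul_comm, Quaternion.coeComplex_mul]
  smul_zero z := smul_zero (op (z : ℍ[ℝ]))
  smul_add z := smul_add (op (z : ℍ[ℝ]))
  add_smul z w x := by
    change op ((z + w : ℂ) : ℍ[ℝ]) • x = op (z : ℍ[ℝ]) • x + op (w : ℍ[ℝ]) • x
    rw [← add_smul, ← MulOpposite.op_add, Quaternion.coeComplex_add]
  zero_smul x := by
    change op ((0 : ℂ) : ℍ[ℝ]) • x = 0
    simp
  norm_smul_le z x := by
    change ‖op (z : ℍ[ℝ]) • x‖ ≤ _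
    rw [norm_op_smul]
    apply le_of_eq
    congr 1
    rw [← sq_eq_sq₀ (norm_nonneg _) (norm_nonneg _), sq, ← Quaternion.normSq_eq_norm_mul_self,
      Quaternion.normSq_def', Complex.sq_norm, Complex.normSq_apply]
    simp
    ring
  inner x y := cpart (qinner x y)
  norm_sq_eq_re_inner x := by
    rw [qinner_self]
    simp only [cpart, Quaternion.re_coe]
    rfl
  conj_inner_symm x y := by
    rw [← star_qinner y x]
    simp [cpart, Complex.ext_iff]
  add_left x y z := by
    rw [qinner_add_left]
    simp [cpart, Complex.ext_iff]
  smul_left x y z := by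
    change cpart (qinner (op (z : ℍ[ℝ]) • x) y) = _
    rw [qinner_smul_left]
    simp [cpart, Complex.ext_iff]

end Basic

section Operators

variable {H : Type*} [NormedAddCommGroup H] [Module ℍ[ℝ]ᵐᵒᵖ H] [QuaternionicInnerProductSpace H]

attribute [local instance] toComplex

theorem inner_eq_cpart (x y : H) : inner ℂ x y = cpart (qinner x y) := rfl

theorem complex_smul_eq (z : ℂ) (x : H) : z • x = op (z : ℍ[ℝ]) • x := rfl

/-- A bounded right-linear operator as a bounded complex-linear operator. -/
noncomputable def toComplexCLM (A : H →L[ℍ[ℝ]ᵐᵒᵖ] H) : H →L[ℂ] H where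
  toFun := A
  map_add' := A.map_add
  map_smul' z x := A.map_smul (op (z : ℍ[ℝ])) x
  cont := A.cont

theorem unitJ_mul_self : unitJ * unitJ = -1 := by
  ext <;> simp

theorem star_unitJ : star unitJ = -unitJ := by
  ext <;> simp

theorem coe_mul_unitJ (z : ℂ) : (z : ℍ[ℝ]) * unitJ = unitJ * ((star z : ℂ) : ℍ[ℝ]) := by
  ext <;> simp

theorem norm_unitJ : ‖unitJ‖ = 1 := by
  have h : ‖unitJ‖ * ‖unitJ‖ = 1 := by
    rw [← Quaternion.normSq_eq_norm_mul_self, Quaternion.normSq_def']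
    simp
  nlinarith [norm_nonneg unitJ]

theorem eq_add_unitJ (q : ℍ[ℝ]) : ∃ z w : ℂ, q = z + w * unitJ :=
  ⟨⟨q.re, q.imI⟩, ⟨q.imJ, q.imK⟩, by ext <;> simp⟩

theorem op_unitJ_op_unitJ {V : Type*} [AddCommGroup V] [Module ℍ[ℝ]ᵐᵒᵖ V] (x : V) :
    op unitJ • op unitJ • x = -x := by
  rw [smul_smul, ← MulOpposite.op_mul, unitJ_mul_self]
  simp

/-- A bounded complex-linear operator commuting with right multiplication by `j` is right-linear
over the quaternions. -/
noncomputable def ofComplexCLM (S : H →L[ℂ] H) (hS : ∀ x, S (op unitJ • x) = op unitJ • S x) :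
    H →L[ℍ[ℝ]ᵐᵒᵖ] H where
  toFun := S
  map_add' := S.map_add
  map_smul' q x := by
    obtain ⟨z, w, h⟩ := eq_add_unitJ q.unop
    have hz : ∀ (z : ℂ) (x : H), S (op (z : ℍ[ℝ]) • x) = op (z : ℍ[ℝ]) • S x :=
      fun z x => S.map_smul z x
    rw [← MulOpposite.op_unop q, h, MulOpposite.op_add, MulOpposite.op_mul, add_smul, mul_smul,
      S.map_add, hz, hS, hz]
    simp [add_smul, mul_smul]
  cont := S.cont

/-- Conjugation of a complex-linear operator by right multiplication by `j`. -/
noncomputable def conjJ (S : H →L[ℂ] H) : H →L[ℂ] H where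
  toFun x := -(op unitJ • S (op unitJ • x))
  map_add' x y := by
    simp only [smul_add, map_add, neg_add]
  map_smul' z x := by
    have h1 : op unitJ • z • x = (star z) • op unitJ • x := by
      rw [complex_smul_eq, complex_smul_eq, smul_smul, smul_smul, ← MulOpposite.op_mul,
        ← MulOpposite.op_mul, coe_mul_unitJ]
    have h2 : ∀ y : H, op unitJ • (star z) • y = z • op unitJ • y := by
      intro y
      rw [complex_smul_eq, complex_smul_eq, smul_smul, smul_smul, ← MulOpposite.op_mul,
        ← MulOpposite.op_mul, coe_mul_unitJ, star_star]
    simp only [RingHom.id_apply]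
    rw [h1, map_smul, h2, smul_neg]
  cont := by
    have h : Continuous fun x : H => op unitJ • x := by
      refine AddMonoidHomClass.continuous_of_bound (DistribSMul.toAddMonoidHom H (op unitJ)) 1 ?_
      intro x
      exact le_of_eq (by simp [norm_op_smul, norm_unitJ])
    exact (h.comp (S.cont.comp h)).neg

/-- Positivity of an operator: `⟨u|Tu⟩` is a non-negative real number for every `u`. -/
def IsPositive (T : H →L[ℍ[ℝ]ᵐᵒᵖ] H) : Prop :=
  ∀ u, ∃ r : ℝ, 0 ≤ r ∧ qinner u (T u) = (r : ℍ[ℝ])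

theorem toComplexCLM_nonneg {S : H →L[ℍ[ℝ]ᵐᵒᵖ] H} (h : IsPositive S) :
    0 ≤ toComplexCLM S := by
  rw [ContinuousLinearMap.nonneg_iff_isPositive, ContinuousLinearMap.isPositive_iff_complex]
  intro x
  obtain ⟨r, hr, h⟩ := h x
  have : inner ℂ ((toComplexCLM S) x) x = (r : ℂ) := by
    rw [inner_eq_cpart]
    change cpart (qinner (S x) x) = _
    rw [← star_qinner, h]
    simp [cpart, Complex.ext_iff]
  rw [this]
  simpa using hr

variable [CompleteSpace H]

/-- Every bounded operator has a bounded adjoint. -/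
theorem exists_adjoint (A : H →L[ℍ[ℝ]ᵐᵒᵖ] H) :
    ∃ B : H →L[ℍ[ℝ]ᵐᵒᵖ] H, ∀ x y, qinner (B x) y = qinner x (A y) := by
  have key : ∀ x y, qinner ((toComplexCLM A).adjoint x) y = qinner x (A y) := by
    intro x y
    have h : ∀ y, cpart (qinner ((toComplexCLM A).adjoint x) y) = cpart (qinner x (A y)) :=
      fun y => (toComplexCLM A).adjoint_inner_left y x
    refine cpart_ext (h y) ?_
    rw [← qinner_smul_right, ← qinner_smul_right, h, map_smul]
  refine ⟨ofComplexCLM (toComplexCLM A).adjoint fun x => ext_qinner fun z => ?_, key⟩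
  rw [key, qinner_smul_left, qinner_smul_left, key]

/-- The adjoint `A*` of a bounded operator. -/
noncomputable def adjoint (A : H →L[ℍ[ℝ]ᵐᵒᵖ] H) : H →L[ℍ[ℝ]ᵐᵒᵖ] H :=
  Classical.choose (exists_adjoint A)

theorem qinner_adjoint_left (A : H →L[ℍ[ℝ]ᵐᵒᵖ] H) (x y : H) :
    qinner (adjoint A x) y = qinner x (A y) :=
  Classical.choose_spec (exists_adjoint A) x y

theorem adjoint_unique {A B : H →L[ℍ[ℝ]ᵐᵒᵖ] H} (h : ∀ x y, qinner (B x) y = qinner x (A y)) :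
    adjoint A = B :=
  ContinuousLinearMap.ext fun x => ext_qinner fun y => by rw [qinner_adjoint_left, h]

theorem adjoint_toComplexCLM (A : H →L[ℍ[ℝ]ᵐᵒᵖ] H) :
    star (toComplexCLM A) = toComplexCLM (adjoint A) := by
  rw [ContinuousLinearMap.star_eq_adjoint, eq_comm, ContinuousLinearMap.eq_adjoint_iff]
  intro x y
  exact congrArg cpart (qinner_adjoint_left A x y)

/-- For every bounded `T` there is exactly one selfadjoint positive `S` with `S² = T* T`. -/
theorem existsUnique_abs (T : H →L[ℍ[ℝ]ᵐᵒᵖ] H) :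
    ∃! S : H →L[ℍ[ℝ]ᵐᵒᵖ] H, adjoint S = S ∧ IsPositive S ∧ S * S = adjoint T * T := by
  set a : H →L[ℂ] H := star (toComplexCLM T) * toComplexCLM T with ha
  have ha' : a = toComplexCLM (adjoint T * T) := by
    rw [ha, adjoint_toComplexCLM]; rfl
  have ha0 : 0 ≤ a := star_mul_self_nonneg _
  set s : H →L[ℂ] H := CFC.sqrt a with hs
  have hs0 : 0 ≤ s := CFC.sqrt_nonneg a
  have hss : s * s = a := CFC.sqrt_mul_sqrt_self a ha0
  have hpos := (ContinuousLinearMap.nonneg_iff_isPositive s).1 hs0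
  have hconj_pos : 0 ≤ conjJ s := by
    rw [ContinuousLinearMap.nonneg_iff_isPositive, ContinuousLinearMap.isPositive_iff_complex]
    intro x
    have h1 := hpos.inner_nonneg_left (op unitJ • x)
    rw [inner_eq_cpart] at h1
    have h2 : qinner (conjJ s x) x
        = unitJ * qinner (s (op unitJ • x)) (op unitJ • x) * star unitJ := by
      change qinner (-(op unitJ • s (op unitJ • x))) x = _
      rw [← neg_one_smul ℍ[ℝ]ᵐᵒᵖ, ← MulOpposite.op_one, ← MulOpposite.op_neg, qinner_smul_left,
        qinner_smul_left, qinner_smul_right, star_unitJ, star_neg, star_one, mul_neg, mul_assoc]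
      simp [mul_assoc, unitJ_mul_self]
    rw [inner_eq_cpart, h2]
    obtain ⟨h3, h4⟩ := Complex.nonneg_iff.1 h1
    simp only [cpart] at h3 h4
    constructor
    · simp [cpart, Complex.ext_iff, star_unitJ, ← h4]
    · simpa [cpart, star_unitJ] using h3
  have hconj_sq : conjJ s * conjJ s = a := by
    ext x
    change -(op unitJ • s (op unitJ • -(op unitJ • s (op unitJ • x)))) = a x
    have h1 : s (s (op unitJ • x)) = op unitJ • a x := by
      change (s * s) (op unitJ • x) = _
      rw [hss, ha']
      exact (adjoint T * T).map_smul (op unitJ) x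
    rw [smul_neg, op_unitJ_op_unitJ, neg_neg, h1, op_unitJ_op_unitJ, neg_neg]
  have hcomm : ∀ x, s (op unitJ • x) = op unitJ • s x := by
    intro x
    have h := CFC.sqrt_unique hconj_sq hconj_pos
    have h1 : op unitJ • s x = op unitJ • conjJ s x := by rw [← h]
    rw [h1]
    change _ = op unitJ • -(op unitJ • s (op unitJ • x))
    rw [smul_neg, op_unitJ_op_unitJ, neg_neg]
  have hSs : toComplexCLM (ofComplexCLM s hcomm) = s := rfl
  have hS_adj : adjoint (ofComplexCLM s hcomm) = ofComplexCLM s hcomm := by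
    refine adjoint_unique fun x y => ?_
    have h : ∀ y, cpart (qinner (s x) y) = cpart (qinner x (s y)) :=
      fun y => hpos.inner_left_eq_inner_right x y
    refine cpart_ext (h y) ?_
    rw [← qinner_smul_right, ← qinner_smul_right]
    change cpart (qinner (s x) (op unitJ • y)) = cpart (qinner x (op unitJ • s y))
    rw [h, hcomm]
  refine ⟨ofComplexCLM s hcomm, ⟨hS_adj, ?_, ?_⟩, ?_⟩
  · intro u
    have h1 := Complex.nonneg_iff.1 (hpos.inner_nonneg_right u)
    rw [inner_eq_cpart] at h1
    refine ⟨(qinner u (s u)).re, h1.1, ?_⟩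
    have h2 : star (qinner u (s u)) = qinner u (s u) := by
      have h3 := qinner_adjoint_left (ofComplexCLM s hcomm) u u
      rw [hS_adj] at h3
      rw [star_qinner]
      exact h3
    exact (Quaternion.star_eq_self.1 h2)
  · ext x
    change (s * s) x = _
    rw [hss, ha']
    rfl
  · rintro S ⟨-, h2, h3⟩
    have h4 : CFC.sqrt a = toComplexCLM S := by
      refine CFC.sqrt_unique ?_ (toComplexCLM_nonneg h2)
      rw [ha', ← h3]
      rfl
    ext x
    change toComplexCLM S x = s x
    rw [← h4]

/-- The absolute value `|T| = √(T* T)`: the unique selfadjoint positive square root of `T* T`. -/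
noncomputable def absOp (T : H →L[ℍ[ℝ]ᵐᵒᵖ] H) : H →L[ℍ[ℝ]ᵐᵒᵖ] H :=
  Classical.choose (existsUnique_abs T).exists

theorem absOp_spec (T : H →L[ℍ[ℝ]ᵐᵒᵖ] H) :
    adjoint (absOp T) = absOp T ∧ IsPositive (absOp T) ∧ absOp T * absOp T = adjoint T * T :=
  Classical.choose_spec (existsUnique_abs T).exists

end Operators

section Traces

variable {H : Type*} [NormedAddCommGroup H] [Module ℍ[ℝ]ᵐᵒᵖ H] [QuaternionicInnerProductSpace H]

/-- A Hilbert basis: an orthonormal set whose quaternionic linear span is dense. -/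
def IsHilbertBasis (N : Set H) : Prop :=
  (∀ u ∈ N, qinner u u = 1) ∧ (∀ u ∈ N, ∀ v ∈ N, u ≠ v → qinner u v = 0) ∧
    Dense (Submodule.span ℍ[ℝ]ᵐᵒᵖ N : Set H)

/-- The orthogonal complement `S^⊥`. -/
def orthogonalComplement (S : Set H) : Set H :=
  {x | ∀ y ∈ S, qinner y x = 0}

/-- The slice `H_{Jι} = {z | Jz = zι}`. -/
def slice (J : H →L[ℍ[ℝ]ᵐᵒᵖ] H) (ι : ℍ[ℝ]) : Set H :=
  {z | J z = op ι • z}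

/-- The `N`-trace `tr_N(A) = ∑_{u ∈ N} ⟨u|Au⟩`. -/
noncomputable def nTrace (N : Set H) (A : H →L[ℍ[ℝ]ᵐᵒᵖ] H) : ℍ[ℝ] :=
  ∑' u : N, qinner (u : H) (A u)

open Classical in
/-- The real trace: the common value of `Re (tr_N(A))` over all Hilbert bases `N`
(with value `0` if there is no common value). -/
noncomputable def realTrace (A : H →L[ℍ[ℝ]ᵐᵒᵖ] H) : ℝ :=
  if h : ∃ r : ℝ, ∀ N : Set H, IsHilbertBasis N → (nTrace N A).re = r then h.choose else 0

open Classical in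
/-- The trace: the common value of `tr_N(A)` over all Hilbert bases `N`
(with value `0` if there is no common value). -/
noncomputable def trace (A : H →L[ℍ[ℝ]ᵐᵒᵖ] H) : ℍ[ℝ] :=
  if h : ∃ t : ℍ[ℝ], ∀ N : Set H, IsHilbertBasis N → nTrace N A = t then h.choose else 0

/-- `T` is of trace class: `∑_{u ∈ N} ⟨u||T|u⟩ < ∞` for some Hilbert basis `N`. The terms of the
series are non-negative real numbers. -/
def IsTraceClass [CompleteSpace H] (T : H →L[ℍ[ℝ]ᵐᵒᵖ] H) : Prop :=
  ∃ N : Set H, IsHilbertBasis N ∧ Summable fun u : N => qinner (u : H) (absOp T u)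

end Traces

end Quaternionic

open Quaternionic QuaternionicInnerProductSpace

/-! Put `D = A - A*`. Since `⟨u|A*u⟩` is the conjugate of `⟨u|Au⟩`, one has `⟨u|Au⟩ = Re⟨u|Au⟩ +
½⟨u|Du⟩`. If `u` belongs to a Hilbert basis in the slice of `J`, then `J*u = u ῑ`, so `⟨u|Du⟩ =
⟨J*u| |D|u⟩ = ι⟨u| |D|u⟩`, and summing over the basis gives the identity. For `J'` the same
computation works because `|D|u` lies in `Ker(D)^⊥`, where `J` and `J'` agree.

Convergence and basis independence come from Hilbert–Schmidt operators. With `R = √|A|` and the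
polar factorization `A = W|A|`, the operator `A = (WR)R` is a product of two of them
(`IsTraceClass.exists_eq_mul`). Polarization expresses the real part of the trace of a product
through Hilbert–Schmidt norms, and these are basis independent by Parseval
(`IsHilbertSchmidt.exists_hasRealTrace_mul`). Finally `|D| = -JD` is a difference of two such
products; its diagonal entries are real, so its real trace is its trace.

The operator theory is done over `ℂ`; a complex operator is quaternionic exactly when it is fixed by
the involution `conjJ`. -/

/-- Douglas' factorization: an operator whose norm is pointwise dominated by that of `T` factors
through `T`. -/
theorem ContinuousLinearMap.exists_apply_eq_of_norm_le {E : Type*} [NormedAddCommGroup E]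
    [InnerProductSpace ℂ E] [CompleteSpace E] (S T : E →L[ℂ] E) (h : ∀ x, ‖S x‖ ≤ ‖T x‖) :
    ∃ W : E →L[ℂ] E, ∀ x, W (T x) = S x := by
  set K := (LinearMap.range T.toLinearMap).topologicalClosure with hK
  have hTK : ∀ x, T x ∈ K := fun x =>
    Submodule.le_topologicalClosure _ (LinearMap.mem_range_self T.toLinearMap x)
  set e : E →ₗ[ℂ] K := T.toLinearMap.codRestrict K hTK with he
  have hde : DenseRange e := by
    rw [DenseRange, Topology.IsInducing.subtypeVal.dense_iff]
    intro x
    have : Subtype.val '' Set.range e = (LinearMap.range T.toLinearMap : Set E) := by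
      ext y
      simp [he]
    have hx : (x : E) ∈ closure (LinearMap.range T.toLinearMap : Set E) := x.2
    rwa [← this] at hx
  have : CompleteSpace K := (Submodule.isClosed_topologicalClosure _).completeSpace_coe
  -- The map `T x ↦ S x` is contractive on the range of `T`. It extends continuously to the closure
  -- `K`, and by zero to the orthogonal complement of `K`.
  refine ⟨(S.toLinearMap.extendOfNorm e).comp K.orthogonalProjectionOnto, fun x => ?_⟩
  have h1 : K.orthogonalProjectionOnto (T x) = e x :=
    Submodule.orthogonalProjectionOnto_mem_subspace_eq_self (K := K) ⟨T x, hTK x⟩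
  rw [ContinuousLinearMap.comp_apply, h1]
  exact LinearMap.extendOfNorm_eq hde ⟨1, fun y => by simpa [he] using h y⟩ x

/-! ### Square roots and polar factorization of quaternionic operators. -/

namespace Quaternionic

section Operators

variable {H : Type*} [NormedAddCommGroup H] [Module ℍ[ℝ]ᵐᵒᵖ H] [QuaternionicInnerProductSpace H]

attribute [local instance] toComplex

theorem qinner_sub_right (x y z : H) : qinner x (y - z) = qinner x y - qinner x z := by
  rw [← star_qinner, qinner_sub_left, star_sub, star_qinner, star_qinner]

theorem qinner_zero_right (x : H) : qinner x (0 : H) = 0 := by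
  have h := qinner_sub_right x 0 0
  simpa using h

theorem qinner_neg_right (x y : H) : qinner x (-y) = -qinner x y := by
  have h := qinner_sub_right x 0 y
  simpa [qinner_zero_right] using h

theorem norm_qinner_comm (x y : H) : ‖qinner x y‖ = ‖qinner y x‖ := by
  rw [← star_qinner, norm_star]

/-- The Cauchy–Schwarz inequality. -/
theorem norm_qinner_le (x y : H) : ‖qinner x y‖ ≤ ‖x‖ * ‖y‖ := by
  set q := qinner x y with hq
  -- Rotating `y` by `star q` makes the scalar product real, so its complex part loses nothing and
  -- the complex inequality applies.
  have h1 : qinner x (op (star q) • y) = ((‖q‖ * ‖q‖ : ℝ) : ℍ[ℝ]) := by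
    rw [qinner_smul_right, ← hq, Quaternion.self_mul_star, Quaternion.normSq_eq_norm_mul_self]
  have h2 : inner ℂ x (op (star q) • y) = ((‖q‖ * ‖q‖ : ℝ) : ℂ) := by
    rw [inner_eq_cpart, h1]
    simp [cpart, Complex.ext_iff]
  have h3 := norm_inner_le_norm (𝕜 := ℂ) x (op (star q) • y)
  rw [h2, norm_op_smul, norm_star, Complex.norm_real, Real.norm_of_nonneg (by positivity)] at h3
  rcases (norm_nonneg q).eq_or_lt with h0 | h0
  · rw [← h0]; positivity
  · nlinarith

theorem norm_add_sq_eq (x y : H) :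
    ‖x + y‖ ^ 2 = ‖x‖ ^ 2 + 2 * (qinner x y).re + ‖y‖ ^ 2 :=
  norm_add_sq (𝕜 := ℂ) x y

/-- Operators commuting with right multiplication by `j` are the fixed points of `conjJ`. -/
theorem map_unitJ_smul_of_conjJ_eq {S : H →L[ℂ] H} (h : conjJ S = S) (x : H) :
    S (op unitJ • x) = op unitJ • S x := by
  have h1 : op unitJ • S x = op unitJ • conjJ S x := by rw [h]
  rw [h1]
  change _ = op unitJ • -(op unitJ • S (op unitJ • x))
  rw [smul_neg, op_unitJ_op_unitJ, neg_neg]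

theorem conjJ_mul (S T : H →L[ℂ] H) : conjJ (S * T) = conjJ S * conjJ T := by
  ext x
  change -(op unitJ • S (T (op unitJ • x)))
    = -(op unitJ • S (op unitJ • -(op unitJ • T (op unitJ • x))))
  rw [smul_neg, op_unitJ_op_unitJ, neg_neg]

theorem conjJ_add (S T : H →L[ℂ] H) : conjJ (S + T) = conjJ S + conjJ T := by
  ext x
  change -(op unitJ • (S (op unitJ • x) + T (op unitJ • x)))
    = -(op unitJ • S (op unitJ • x)) + -(op unitJ • T (op unitJ • x))
  rw [smul_add, neg_add]

theorem conjJ_conjJ (S : H →L[ℂ] H) : conjJ (conjJ S) = S := by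
  ext x
  change -(op unitJ • -(op unitJ • S (op unitJ • op unitJ • x))) = S x
  rw [smul_neg, op_unitJ_op_unitJ, op_unitJ_op_unitJ, neg_neg, map_neg, neg_neg]

theorem conjJ_toComplexCLM (A : H →L[ℍ[ℝ]ᵐᵒᵖ] H) : conjJ (toComplexCLM A) = toComplexCLM A := by
  ext x
  change -(op unitJ • A (op unitJ • x)) = A x
  rw [map_smul, op_unitJ_op_unitJ, neg_neg]

/-- Conjugating a quaternion by `j` conjugates its complex part, and a non-negative real number is
unchanged by that. -/
theorem conjJ_nonneg [CompleteSpace H] {s : H →L[ℂ] H} (hs : 0 ≤ s) : 0 ≤ conjJ s := by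
  rw [ContinuousLinearMap.nonneg_iff_isPositive] at hs
  rw [ContinuousLinearMap.nonneg_iff_isPositive, ContinuousLinearMap.isPositive_iff_complex]
  intro x
  have h1 := hs.inner_nonneg_left (op unitJ • x)
  rw [inner_eq_cpart] at h1
  have h2 : qinner (conjJ s x) x
      = unitJ * qinner (s (op unitJ • x)) (op unitJ • x) * star unitJ := by
    change qinner (-(op unitJ • s (op unitJ • x))) x = _
    rw [← star_qinner, qinner_neg_right, star_neg, star_qinner, qinner_smul_left,
      qinner_smul_right, star_unitJ, mul_neg, mul_assoc, mul_assoc, unitJ_mul_self]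
    simp
  rw [inner_eq_cpart, h2]
  obtain ⟨h3, h4⟩ := Complex.nonneg_iff.1 h1
  simp only [cpart] at h3 h4
  constructor
  · simp [cpart, Complex.ext_iff, star_unitJ, ← h4]
  · simpa [cpart, star_unitJ] using h3

theorem exists_norm_apply_le (B : H →L[ℍ[ℝ]ᵐᵒᵖ] H) : ∃ C : ℝ, 0 ≤ C ∧ ∀ x, ‖B x‖ ≤ C * ‖x‖ :=
  ⟨‖toComplexCLM B‖, norm_nonneg _, (toComplexCLM B).le_opNorm⟩

variable [CompleteSpace H]

theorem qinner_adjoint_right (A : H →L[ℍ[ℝ]ᵐᵒᵖ] H) (x y : H) :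
    qinner x (adjoint A y) = qinner (A x) y := by
  rw [← star_qinner, qinner_adjoint_left, star_qinner]

theorem adjoint_mul (A B : H →L[ℍ[ℝ]ᵐᵒᵖ] H) : adjoint (A * B) = adjoint B * adjoint A :=
  adjoint_unique fun x y => by
    change qinner (adjoint B (adjoint A x)) y = qinner x (A (B y))
    rw [qinner_adjoint_left, qinner_adjoint_left]

/-- A positive operator has a selfadjoint square root. -/
theorem exists_sqrt_of_isPositive {S : H →L[ℍ[ℝ]ᵐᵒᵖ] H} (hS : IsPositive S) :
    ∃ R : H →L[ℍ[ℝ]ᵐᵒᵖ] H, adjoint R = R ∧ R * R = S := by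
  set s : H →L[ℂ] H := CFC.sqrt (toComplexCLM S) with hs
  have hs0 : 0 ≤ s := CFC.sqrt_nonneg _
  have hss : s * s = toComplexCLM S := CFC.sqrt_mul_sqrt_self _ (toComplexCLM_nonneg hS)
  -- `conjJ s` is another positive square root of the same operator, so uniqueness forces `s` to
  -- commute with `j`.
  have hconj : conjJ s = s := by
    refine (CFC.sqrt_unique ?_ (conjJ_nonneg hs0)).symm
    rw [← conjJ_mul, hss, conjJ_toComplexCLM]
  have hcomm := map_unitJ_smul_of_conjJ_eq hconj
  refine ⟨ofComplexCLM s hcomm, adjoint_unique fun x y => ?_, ?_⟩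
  · have hpos := (ContinuousLinearMap.nonneg_iff_isPositive s).1 hs0
    have h : ∀ y, cpart (qinner (s x) y) = cpart (qinner x (s y)) :=
      fun y => hpos.inner_left_eq_inner_right x y
    refine cpart_ext (h y) ?_
    rw [← qinner_smul_right, ← qinner_smul_right]
    change cpart (qinner (s x) (op unitJ • y)) = cpart (qinner x (op unitJ • s y))
    rw [h, hcomm]
  · ext x
    change (s * s) x = S x
    rw [hss]
    rfl

theorem norm_absOp_apply (T : H →L[ℍ[ℝ]ᵐᵒᵖ] H) (x : H) : ‖absOp T x‖ = ‖T x‖ := by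
  obtain ⟨h1, -, h3⟩ := absOp_spec T
  have h : qinner (absOp T x) (absOp T x) = qinner (T x) (T x) := by
    rw [← qinner_adjoint_right, ← qinner_adjoint_right, h1]
    exact congrArg (fun S : H →L[ℍ[ℝ]ᵐᵒᵖ] H => qinner x (S x)) h3
  rw [qinner_self, qinner_self, Quaternion.coe_inj] at h
  exact (pow_left_inj₀ (norm_nonneg _) (norm_nonneg _) two_ne_zero).1 h

/-- The polar decomposition: `T = W |T|` for a bounded right-linear `W`. -/
theorem exists_mul_absOp_eq (T : H →L[ℍ[ℝ]ᵐᵒᵖ] H) :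
    ∃ W : H →L[ℍ[ℝ]ᵐᵒᵖ] H, W * absOp T = T := by
  obtain ⟨V, hV⟩ := ContinuousLinearMap.exists_apply_eq_of_norm_le (toComplexCLM T)
    (toComplexCLM (absOp T)) fun x => (norm_absOp_apply T x).ge
  -- The complex factor `V` need not commute with `j`. Both `V` and `conjJ V` carry `|T|` to `T`,
  -- hence so does their average, which is fixed by `conjJ`.
  have hconj : conjJ (V + conjJ V) = V + conjJ V := by
    rw [conjJ_add, conjJ_conjJ, add_comm]
  have hV' : V * toComplexCLM (absOp T) = toComplexCLM T := ContinuousLinearMap.ext hV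
  have hV'' : conjJ V * toComplexCLM (absOp T) = toComplexCLM T := by
    rw [← conjJ_toComplexCLM (absOp T), ← conjJ_mul, hV', conjJ_toComplexCLM]
  have hcomm := map_unitJ_smul_of_conjJ_eq hconj
  have hcomm' : ∀ x, ((1 / 2 : ℂ) • (V + conjJ V)) (op unitJ • x)
      = op unitJ • ((1 / 2 : ℂ) • (V + conjJ V)) x := by
    intro x
    rw [_root_.smul_apply, _root_.smul_apply, hcomm, complex_smul_eq,
      complex_smul_eq, smul_smul, smul_smul, ← MulOpposite.op_mul, ← MulOpposite.op_mul,
      coe_mul_unitJ]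
    simp
  refine ⟨ofComplexCLM _ hcomm', ?_⟩
  ext x
  change (((1 / 2 : ℂ) • (V + conjJ V)) * toComplexCLM (absOp T)) x = toComplexCLM T x
  rw [smul_mul_assoc, add_mul, hV', hV'', ← two_smul ℂ, smul_smul]
  norm_num

end Operators

end Quaternionic

/-! ### Hilbert–Schmidt operators and basis independence of traces. -/

namespace Quaternionic

section Sums

variable {H : Type*} [NormedAddCommGroup H] [Module ℍ[ℝ]ᵐᵒᵖ H]

/-- The squared Hilbert–Schmidt norm of `S`, computed in `N`. -/
noncomputable def hsNormSq (N : Set H) (S : H →L[ℍ[ℝ]ᵐᵒᵖ] H) : ENNReal :=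
  ∑' u : N, ENNReal.ofReal (‖S u‖ ^ 2)

theorem tsum_norm_sq_eq (S : H →L[ℍ[ℝ]ᵐᵒᵖ] H) (N : Set H) :
    ∑' u : N, ‖S u‖ ^ 2 = (hsNormSq N S).toReal := by
  rw [hsNormSq, ENNReal.tsum_toReal_eq fun _ => ENNReal.ofReal_ne_top]
  exact tsum_congr fun u => (ENNReal.toReal_ofReal (by positivity)).symm

theorem hasSum_re {α : Type*} {f : α → ℍ[ℝ]} {q : ℍ[ℝ]} (h : HasSum f q) :
    HasSum (fun a => (f a).re) q.re := by
  have hc : Continuous fun q : ℍ[ℝ] => q.re := Quaternion.continuous_re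
  exact h.map (⟨⟨fun q : ℍ[ℝ] => q.re, rfl⟩, fun _ _ => rfl⟩ : ℍ[ℝ] →+ ℝ) hc

end Sums

section HilbertSchmidt

variable {H : Type*} [NormedAddCommGroup H] [Module ℍ[ℝ]ᵐᵒᵖ H] [QuaternionicInnerProductSpace H]

attribute [local instance] toComplex

/-- The functional `⟨x - y|·⟩` is continuous and vanishes on the dense span of `N`, hence also at `x
- y`. -/
theorem eq_of_forall_mem_qinner_eq {N : Set H} (hN : IsHilbertBasis N) {x y : H}
    (h : ∀ u ∈ N, qinner x u = qinner y u) : x = y := by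
  have hspan : ∀ v ∈ Submodule.span ℍ[ℝ]ᵐᵒᵖ N, qinner (x - y) v = 0 := by
    intro v hv
    induction hv using Submodule.span_induction with
    | mem u hu => rw [qinner_sub_left, h u hu, sub_self]
    | zero => exact qinner_zero_right _
    | add a b _ _ ha hb => rw [qinner_add_right, ha, hb, add_zero]
    | smul q a _ ha => rw [← MulOpposite.op_unop q, qinner_smul_right, ha, zero_mul]
  have hcont : Continuous fun v => qinner (x - y) v := by
    refine AddMonoidHomClass.continuous_of_bound
      (AddMonoidHom.mk' (fun v => qinner (x - y) v) (qinner_add_right _)) ‖x - y‖ ?_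
    exact norm_qinner_le (x - y)
  have h0 : (fun v => qinner (x - y) v) = fun _ => 0 :=
    hcont.ext_on hN.2.2 continuous_const hspan
  have h1 := congrFun h0 (x - y)
  simp only [qinner_self] at h1
  rw [← Quaternion.coe_zero, Quaternion.coe_inj] at h1
  exact sub_eq_zero.1 (norm_eq_zero.1 (pow_eq_zero_iff two_ne_zero |>.1 h1))

/-- The complex orthonormal family `u, uj` with `u` in the set `N`. -/
noncomputable def complexFamily (N : Set H) (p : N × Bool) : H :=
  if p.2 then op unitJ • (p.1 : H) else (p.1 : H)

theorem orthonormal_complexFamily {N : Set H} (hN : IsHilbertBasis N) :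
    Orthonormal ℂ (complexFamily N) := by
  classical
  rw [orthonormal_iff_ite]
  rintro ⟨u, a⟩ ⟨v, b⟩
  by_cases huv : u = v
  · subst huv
    have hu : ‖(u : H)‖ = 1 := by
      have h := qinner_self (u : H)
      rw [hN.1 u u.2, ← Quaternion.coe_one, Quaternion.coe_inj] at h
      exact (pow_eq_one_iff_of_nonneg (norm_nonneg _) two_ne_zero).1 h.symm
    cases a <;> cases b <;>
      simp [complexFamily, inner_eq_cpart, qinner_smul_left, qinner_smul_right, hN.1 u u.2, cpart,
        hu, norm_op_smul, norm_unitJ,        Complex.ext_iff]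
  · have h0 : qinner (u : H) (v : H) = 0 :=
      hN.2.1 u u.2 v v.2 fun h => huv (Subtype.ext h)
    cases a <;> cases b <;>
      simp [complexFamily, inner_eq_cpart, qinner_smul_left, qinner_smul_right, h0, cpart, huv,
        Complex.ext_iff]

/-- For `q = ⟨u|x⟩` the two terms are the squared complex coefficients of `x` along `u` and `uj`.
This turns complex Parseval into quaternionic Parseval. -/
theorem norm_sq_cpart_add (q : ℍ[ℝ]) :
    ‖cpart q‖ ^ 2 + ‖cpart (star unitJ * q)‖ ^ 2 = ‖q‖ ^ 2 := by
  rw [sq ‖q‖, ← Quaternion.normSq_eq_norm_mul_self, Quaternion.normSq_def', Complex.sq_norm,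
    Complex.sq_norm, Complex.normSq_apply, Complex.normSq_apply]
  simp [cpart]
  ring

theorem orthogonal_span_complexFamily {N : Set H} (hN : IsHilbertBasis N) :
    (Submodule.span ℂ (Set.range (complexFamily N)))ᗮ = ⊥ := by
  rw [Submodule.eq_bot_iff]
  intro x hx
  refine eq_of_forall_mem_qinner_eq hN fun u hu => ?_
  have key : ∀ b, inner ℂ (complexFamily N (⟨u, hu⟩, b)) x = 0 := fun b =>
    (Submodule.mem_orthogonal _ _).1 hx _ (Submodule.subset_span ⟨_, rfl⟩)
  have h1 : cpart (qinner u x) = 0 := key false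
  have h2 : cpart (star unitJ * qinner u x) = 0 := by
    rw [← qinner_smul_left]
    exact key true
  have h3 := norm_sq_cpart_add (qinner u x)
  rw [h1, h2] at h3
  have h4 : qinner u x = 0 := by simpa using h3.symm
  have h5 := qinner_zero_right u
  rw [← star_qinner, h4, ← star_qinner, h5]

/-- A Hilbert–Schmidt operator: its Hilbert–Schmidt norm is finite in every Hilbert basis. -/
def IsHilbertSchmidt (S : H →L[ℍ[ℝ]ᵐᵒᵖ] H) : Prop :=
  ∀ N : Set H, IsHilbertBasis N → hsNormSq N S ≠ ⊤

theorem IsHilbertSchmidt.summable {S : H →L[ℍ[ℝ]ᵐᵒᵖ] H} (h : IsHilbertSchmidt S) {N : Set H}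
    (hN : IsHilbertBasis N) : Summable fun u : N => ‖S u‖ ^ 2 := by
  have h1 := ENNReal.summable_toReal (h N hN)
  refine h1.congr fun u => ?_
  rw [ENNReal.toReal_ofReal (by positivity)]

/-- `T` is summable along every Hilbert basis, and the real part of the sum is always `r`. -/
def HasRealTrace (T : H →L[ℍ[ℝ]ᵐᵒᵖ] H) (r : ℝ) : Prop :=
  ∀ M : Set H, IsHilbertBasis M →
    (Summable fun u : M => qinner (u : H) (T u)) ∧ (nTrace M T).re = r

theorem HasRealTrace.sub {S T : H →L[ℍ[ℝ]ᵐᵒᵖ] H} {r s : ℝ} (hS : HasRealTrace S r)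
    (hT : HasRealTrace T s) : HasRealTrace (S - T) (r - s) := fun M hM => by
  obtain ⟨h1, rfl⟩ := hS M hM
  obtain ⟨h2, rfl⟩ := hT M hM
  have h3 : (fun u : M => qinner (u : H) ((S - T) u))
      = fun u : M => qinner (u : H) (S u) - qinner (u : H) (T u) :=
    funext fun u => qinner_sub_right _ _ _
  refine ⟨h3 ▸ h1.sub h2, ?_⟩
  rw [nTrace, h3, h1.tsum_sub h2]
  rfl

theorem HasRealTrace.re_nTrace {T : H →L[ℍ[ℝ]ᵐᵒᵖ] H} {r : ℝ} (h : HasRealTrace T r) {M : Set H}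
    (hM : IsHilbertBasis M) : (nTrace M T).re = realTrace T := by
  have hex : ∃ r : ℝ, ∀ N : Set H, IsHilbertBasis N → (nTrace N T).re = r :=
    ⟨r, fun N hN => (h N hN).2⟩
  rw [realTrace, dif_pos hex]
  exact hex.choose_spec M hM

/-- For positive operators, the trace is determined by its real part. -/
theorem HasRealTrace.nTrace_eq_trace {T : H →L[ℍ[ℝ]ᵐᵒᵖ] H} {r : ℝ} (h : HasRealTrace T r)
    (hT : IsPositive T) {M : Set H} (hM : IsHilbertBasis M) : nTrace M T = trace T := by
  have hreal : ∀ N : Set H, IsHilbertBasis N → nTrace N T = (r : ℍ[ℝ]) := by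
    intro N hN
    -- Every term of the series is real, so conjugation fixes the sum.
    have hstar : star (nTrace N T) = nTrace N T := by
      rw [nTrace, tsum_star]
      refine tsum_congr fun u => ?_
      obtain ⟨a, -, ha⟩ := hT u
      rw [ha, Quaternion.star_coe]
    rw [← (h N hN).2]
    exact Quaternion.star_eq_self.1 hstar
  have hex : ∃ t : ℍ[ℝ], ∀ N : Set H, IsHilbertBasis N → nTrace N T = t := ⟨r, hreal⟩
  rw [trace, dif_pos hex]
  exact hex.choose_spec M hM

variable [CompleteSpace H]

/-- Parseval's identity. -/
theorem tsum_norm_qinner_sq {N : Set H} (hN : IsHilbertBasis N) (x : H) :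
    ∑' u : N, ENNReal.ofReal (‖qinner (u : H) x‖ ^ 2) = ENNReal.ofReal (‖x‖ ^ 2) := by
  set b := HilbertBasis.mkOfOrthogonalEqBot (orthonormal_complexFamily hN)
    (orthogonal_span_complexFamily hN)
  have hb : ∀ p, b p = complexFamily N p := fun p =>
    congrFun (HilbertBasis.coe_mkOfOrthogonalEqBot _ _) p
  have h1 : HasSum (fun p => ‖inner ℂ (complexFamily N p) x‖ ^ 2) (‖x‖ ^ 2) := by
    have h := (b.hasSum_inner_mul_inner x x).mapL Complex.reCLM
    convert h using 1
    · funext p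
      rw [← hb p, ← inner_conj_symm x, ← Complex.normSq_eq_conj_mul_self, Complex.reCLM_apply,
        Complex.ofReal_re, Complex.sq_norm]
    · exact (inner_self_eq_norm_sq (𝕜 := ℂ) x).symm
  rw [← h1.tsum_eq, ENNReal.ofReal_tsum_of_nonneg (fun _ => by positivity) h1.summable,
    ENNReal.summable.tsum_prod' fun _ => ENNReal.summable]
  refine tsum_congr fun u => ?_
  rw [tsum_bool, ← norm_sq_cpart_add (qinner (u : H) x),
    ENNReal.ofReal_add (by positivity) (by positivity), ← qinner_smul_left]
  rfl

/-- By Parseval both sides are the double sum of `|⟨v|Su⟩|²` over `u ∈ N`, `v ∈ M`. In `ENNReal` the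
order of summation may be exchanged without any convergence assumption. -/
theorem hsNormSq_adjoint {N M : Set H} (hN : IsHilbertBasis N) (hM : IsHilbertBasis M)
    (S : H →L[ℍ[ℝ]ᵐᵒᵖ] H) : hsNormSq M (adjoint S) = hsNormSq N S := by
  have h1 : hsNormSq N S
      = ∑' u : N, ∑' v : M, ENNReal.ofReal (‖qinner (v : H) (S u)‖ ^ 2) :=
    tsum_congr fun u => (tsum_norm_qinner_sq hM _).symm
  have h2 : hsNormSq M (adjoint S)
      = ∑' v : M, ∑' u : N, ENNReal.ofReal (‖qinner (u : H) (adjoint S v)‖ ^ 2) :=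
    tsum_congr fun v => (tsum_norm_qinner_sq hN _).symm
  rw [h1, h2, ENNReal.tsum_comm]
  refine tsum_congr fun u => tsum_congr fun v => ?_
  rw [qinner_adjoint_right, norm_qinner_comm]

theorem hsNormSq_eq {N M : Set H} (hN : IsHilbertBasis N) (hM : IsHilbertBasis M)
    (S : H →L[ℍ[ℝ]ᵐᵒᵖ] H) : hsNormSq M S = hsNormSq N S := by
  rw [← hsNormSq_adjoint hN hN S, ← hsNormSq_adjoint hM hN S]

theorem IsHilbertSchmidt.of_ne_top {S : H →L[ℍ[ℝ]ᵐᵒᵖ] H} {N : Set H} (hN : IsHilbertBasis N)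
    (h : hsNormSq N S ≠ ⊤) : IsHilbertSchmidt S := fun M hM => by
  rwa [hsNormSq_eq hN hM]

theorem IsHilbertSchmidt.adjoint {S : H →L[ℍ[ℝ]ᵐᵒᵖ] H} (h : IsHilbertSchmidt S) :
    IsHilbertSchmidt (adjoint S) := fun M hM => by
  rw [hsNormSq_adjoint hM hM]
  exact h M hM

theorem IsHilbertSchmidt.of_summable {S : H →L[ℍ[ℝ]ᵐᵒᵖ] H} {N : Set H} (hN : IsHilbertBasis N)
    (h : Summable fun u : N => ‖S u‖ ^ 2) : IsHilbertSchmidt S :=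
  .of_ne_top hN h.tsum_ofReal_ne_top

theorem IsHilbertSchmidt.mul_left {S : H →L[ℍ[ℝ]ᵐᵒᵖ] H} (h : IsHilbertSchmidt S)
    (B : H →L[ℍ[ℝ]ᵐᵒᵖ] H) : IsHilbertSchmidt (B * S) := fun N hN => by
  obtain ⟨C, hC, hB⟩ := exists_norm_apply_le B
  have h1 : Summable fun u : N => ‖(B * S) u‖ ^ 2 := by
    refine Summable.of_nonneg_of_le (fun _ => by positivity) (fun u => ?_)
      ((h.summable hN).mul_left (C ^ 2))
    rw [← mul_pow]
    exact pow_le_pow_left₀ (norm_nonneg _) (hB (S u)) 2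
  exact IsHilbertSchmidt.of_summable hN h1 N hN

theorem IsHilbertSchmidt.add {S T : H →L[ℍ[ℝ]ᵐᵒᵖ] H} (hS : IsHilbertSchmidt S)
    (hT : IsHilbertSchmidt T) : IsHilbertSchmidt (S + T) := fun N hN => by
  have h1 : Summable fun u : N => ‖(S + T) u‖ ^ 2 := by
    refine Summable.of_nonneg_of_le (fun _ => by positivity) (fun u => ?_)
      (((hS.summable hN).mul_left 2).add ((hT.summable hN).mul_left 2))
    have h2 : ‖(S + T) u‖ ≤ ‖S u‖ + ‖T u‖ := norm_add_le _ _
    nlinarith [norm_nonneg ((S + T) u), norm_nonneg (S u), norm_nonneg (T u),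
      sq_nonneg (‖S u‖ - ‖T u‖)]
  exact IsHilbertSchmidt.of_summable hN h1 N hN

/-- The product of two Hilbert–Schmidt operators has a real trace. -/
theorem IsHilbertSchmidt.exists_hasRealTrace_mul {S T : H →L[ℍ[ℝ]ᵐᵒᵖ] H}
    (hS : IsHilbertSchmidt S) (hT : IsHilbertSchmidt T) : ∃ r, HasRealTrace (S * T) r := by
  set X := Quaternionic.adjoint S with hX
  have hXs : IsHilbertSchmidt X := hS.adjoint
  have hXT : IsHilbertSchmidt (X + T) := hXs.add hT
  have hq : ∀ u, qinner u ((S * T) u) = qinner (X u) (T u) := fun u =>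
    (qinner_adjoint_left S u (T u)).symm
  have hsum : ∀ M : Set H, IsHilbertBasis M →
      Summable fun u : M => qinner (u : H) ((S * T) u) := by
    intro M hM
    refine Summable.of_norm_bounded ((hXs.summable hM).add (hT.summable hM)) fun u => ?_
    rw [hq]
    nlinarith [norm_qinner_le (X u) (T u), sq_nonneg (‖X u‖ - ‖T u‖), sq_nonneg (‖X u‖ + ‖T u‖)]
  -- Polarization of `Re⟨S*u|Tu⟩`, summed over the basis.
  have htr : ∀ M : Set H, IsHilbertBasis M → (nTrace M (S * T)).re
      = ((hsNormSq M (X + T)).toReal - (hsNormSq M X).toReal - (hsNormSq M T).toReal) / 2 := by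
    intro M hM
    rw [nTrace, ← (hasSum_re (hsum M hM).hasSum).tsum_eq, ← tsum_norm_sq_eq, ← tsum_norm_sq_eq,
      ← tsum_norm_sq_eq, ← (hXT.summable hM).tsum_sub (hXs.summable hM),
      ← ((hXT.summable hM).sub (hXs.summable hM)).tsum_sub (hT.summable hM), ← tsum_div_const]
    refine tsum_congr fun u => ?_
    have h := norm_add_sq_eq (X u) (T u)
    rw [hq]
    change _ = (‖X u + T u‖ ^ 2 - _ - _) / 2
    linarith
  -- A basis is needed only to name the common value; without one every value works.
  by_cases hex : ∃ N : Set H, IsHilbertBasis N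
  · obtain ⟨N, hN⟩ := hex
    refine ⟨(nTrace N (S * T)).re, fun M hM => ⟨hsum M hM, ?_⟩⟩
    rw [htr M hM, htr N hN, hsNormSq_eq hN hM, hsNormSq_eq hN hM, hsNormSq_eq hN hM]
  · exact ⟨0, fun M hM => (hex ⟨M, hM⟩).elim⟩

/-- A trace class operator is a product of two Hilbert–Schmidt operators. -/
theorem IsTraceClass.exists_eq_mul {A : H →L[ℍ[ℝ]ᵐᵒᵖ] H} (hA : IsTraceClass A) :
    ∃ S T : H →L[ℍ[ℝ]ᵐᵒᵖ] H, IsHilbertSchmidt S ∧ IsHilbertSchmidt T ∧ A = S * T := by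
  obtain ⟨N, hN, hsum⟩ := hA
  obtain ⟨R, hR, hRR⟩ := exists_sqrt_of_isPositive (absOp_spec A).2.1
  obtain ⟨W, hW⟩ := exists_mul_absOp_eq A
  have hRs : IsHilbertSchmidt R := by
    refine .of_summable hN ((hasSum_re hsum.hasSum).summable.congr fun u => ?_)
    have h : qinner (u : H) (absOp A u) = qinner (R u) (R u) := by
      rw [← qinner_adjoint_right, hR, ← hRR]
      rfl
    rw [h, qinner_self, Quaternion.re_coe]
  exact ⟨W * R, R, hRs.mul_left W, hRs, by rw [mul_assoc, hRR, hW]⟩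

end HilbertSchmidt

end Quaternionic

/-! ### Traces along bases contained in a slice. -/

namespace Quaternionic

section SliceTrace

variable {H : Type*} [NormedAddCommGroup H] [Module ℍ[ℝ]ᵐᵒᵖ H] [QuaternionicInnerProductSpace H]
  [CompleteSpace H]

theorem IsTraceClass.exists_hasRealTrace {A : H →L[ℍ[ℝ]ᵐᵒᵖ] H} (hA : IsTraceClass A) :
    ∃ r, HasRealTrace A r := by
  obtain ⟨S, T, hS, hT, rfl⟩ := hA.exists_eq_mul
  exact hS.exists_hasRealTrace_mul hT

/-- If `A` is of trace class then so is `|A - A*|`, when it is given by a polar decomposition with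
an imaginary unit `J`. -/
theorem IsTraceClass.exists_hasRealTrace_absOp_sub_adjoint {A J : H →L[ℍ[ℝ]ᵐᵒᵖ] H}
    (hA : IsTraceClass A) (hJ : J * J = -1) (hpolar : A - adjoint A = J * absOp (A - adjoint A)) :
    ∃ r, HasRealTrace (absOp (A - adjoint A)) r := by
  obtain ⟨S, T, hS, hT, hST⟩ := hA.exists_eq_mul
  -- Apply `J` to the polar identity, use `J² = -1`, and expand with `A = ST` and `A* = T*S*`.
  have h1 : absOp (A - adjoint A) = J * adjoint T * adjoint S - J * S * T := by
    have h2 : J * (A - adjoint A) = -absOp (A - adjoint A) := by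
      conv_lhs => rw [hpolar]
      rw [← mul_assoc, hJ]
      rfl
    have h3 : adjoint A = adjoint T * adjoint S := by rw [hST, adjoint_mul]
    rw [← neg_eq_iff_eq_neg.2 h2, h3, mul_sub, neg_sub, mul_assoc, mul_assoc, ← hST]
  obtain ⟨r, hr⟩ := (hT.adjoint.mul_left J).exists_hasRealTrace_mul hS.adjoint
  obtain ⟨s, hs⟩ := (hS.mul_left J).exists_hasRealTrace_mul hT
  exact ⟨r - s, h1 ▸ hr.sub hs⟩

/-- `|D|` is selfadjoint and vanishes on the kernel of `D`, so its range is orthogonal to that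
kernel. This is where `J` may be exchanged for `J'`. -/
theorem absOp_apply_mem_orthogonalComplement (D : H →L[ℍ[ℝ]ᵐᵒᵖ] H) (x : H) :
    absOp D x ∈ orthogonalComplement {y : H | D y = 0} := by
  intro y hy
  have h : absOp D y = 0 := by
    rw [← norm_eq_zero, norm_absOp_apply, norm_eq_zero]
    exact hy
  rw [← (absOp_spec D).1, qinner_adjoint_right, h, ← star_qinner, qinner_zero_right, star_zero]

/-- If a Hilbert basis consists of right eigenvectors of `J` with eigenvalue `ι`, then its elements
are right eigenvectors of `J*` with eigenvalue `star ι`. -/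
theorem adjoint_apply_of_mem_slice {J : H →L[ℍ[ℝ]ᵐᵒᵖ] H} {ι : ℍ[ℝ]} {N : Set H}
    (hN : IsHilbertBasis N) (hNJ : N ⊆ slice J ι) {u : H} (hu : u ∈ N) :
    adjoint J u = op (star ι) • u := by
  refine eq_of_forall_mem_qinner_eq hN fun v hv => ?_
  have hJv : J v = op ι • v := hNJ hv
  rw [qinner_adjoint_left, hJv, qinner_smul_right, qinner_smul_left, star_star]
  -- The claim is now that `ι` commutes with `⟨u|v⟩`, which is `0` or `1` by orthonormality.
  by_cases huv : u = v
  · rw [← huv, hN.1 u hu, one_mul, mul_one]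
  · rw [hN.2.1 u hu v hv huv, zero_mul, mul_zero]

/-- Replace `J` by `J'` on the range of `|A - A*|`, then move `J'` to the left entry, where its
adjoint acts on `u` by `star ι`; conjugate linearity there brings out `ι` on the left. -/
theorem qinner_sub_adjoint_apply_self {A J J' : H →L[ℍ[ℝ]ᵐᵒᵖ] H} {ι : ℍ[ℝ]}
    (hpolar : A - adjoint A = J * absOp (A - adjoint A))
    (hJ' : ∀ x ∈ orthogonalComplement {y : H | (A - adjoint A) y = 0}, J x = J' x)
    {N : Set H} (hN : IsHilbertBasis N) (hNJ : N ⊆ slice J' ι) {u : H} (hu : u ∈ N) :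
    qinner u ((A - adjoint A) u) = ι * qinner u (absOp (A - adjoint A) u) := by
  have h1 : (A - adjoint A) u = J (absOp (A - adjoint A) u) :=
    congrArg (fun S : H →L[ℍ[ℝ]ᵐᵒᵖ] H => S u) hpolar
  rw [h1, hJ' _ (absOp_apply_mem_orthogonalComplement _ u), ← qinner_adjoint_left,
    adjoint_apply_of_mem_slice hN hNJ hu, qinner_smul_left, star_star]

/-- The diagonal entry of `A - A*` is `q - star q` with `q = ⟨u|Au⟩`, that is, twice the imaginary
part of `q`. -/
theorem qinner_apply_self_eq (A : H →L[ℍ[ℝ]ᵐᵒᵖ] H) (u : H) :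
    qinner u (A u) = ((qinner u (A u)).re : ℍ[ℝ]) + (1 / 2) * qinner u ((A - adjoint A) u) := by
  have h : qinner u ((A - adjoint A) u) = qinner u (A u) - star (qinner u (A u)) := by
    rw [star_qinner, ← qinner_adjoint_right]
    exact qinner_sub_right _ _ _
  have h2 : (1 / 2 : ℍ[ℝ]) = ((1 / 2 : ℝ) : ℍ[ℝ]) := by push_cast; rfl
  rw [h, h2, Quaternion.coe_mul_eq_smul]
  ext <;> simp <;> ring

theorem nTrace_eq_of_subset_slice {A J J' : H →L[ℍ[ℝ]ᵐᵒᵖ] H} {ι : ℍ[ℝ]} (hA : IsTraceClass A)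
    (hJ : J * J = -1) (hpolar : A - adjoint A = J * absOp (A - adjoint A))
    (hJ' : ∀ x ∈ orthogonalComplement {y : H | (A - adjoint A) y = 0}, J x = J' x)
    {N : Set H} (hN : IsHilbertBasis N) (hNJ : N ⊆ slice J' ι) :
    nTrace N A = (realTrace A : ℍ[ℝ]) + ι / 2 * trace (absOp (A - adjoint A)) := by
  obtain ⟨r, hr⟩ := hA.exists_hasRealTrace
  obtain ⟨s, hs⟩ := hA.exists_hasRealTrace_absOp_sub_adjoint hJ hpolar
  have hre : HasSum (fun u : N => ((qinner (u : H) (A u)).re : ℍ[ℝ])) (realTrace A : ℍ[ℝ]) := by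
    rw [← hr.re_nTrace hN]
    exact Quaternion.hasSum_coe.2 (hasSum_re (hr N hN).1.hasSum)
  have habs : HasSum (fun u : N => qinner (u : H) (absOp (A - adjoint A) u))
      (trace (absOp (A - adjoint A))) := by
    rw [← hs.nTrace_eq_trace (absOp_spec _).2.1 hN]
    exact (hs N hN).1.hasSum
  -- Quaternions do not commute in general, but `1 / 2` is real and hence central.
  have hcomm : (1 / 2 : ℍ[ℝ]) * ι = ι / 2 := by
    have h2 : (1 / 2 : ℍ[ℝ]) = ((1 / 2 : ℝ) : ℍ[ℝ]) := by push_cast; rfl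
    rw [h2, Quaternion.coe_commutes, ← h2, mul_one_div]
  refine (hre.add (habs.mul_left (ι / 2))).tsum_eq ▸ tsum_congr fun u => ?_
  have h := qinner_apply_self_eq A (u : H)
  rwa [qinner_sub_adjoint_apply_self hpolar hJ' hN hNJ u.2, ← mul_assoc, hcomm] at h

end SliceTrace

end Quaternionic

theorem proposition2p4 {H : Type*} [NormedAddCommGroup H] [Module ℍ[ℝ]ᵐᵒᵖ H]
    [QuaternionicInnerProductSpace H] [CompleteSpace H]
    (A : H →L[ℍ[ℝ]ᵐᵒᵖ] H) (hA : IsTraceClass A)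
    (J : H →L[ℍ[ℝ]ᵐᵒᵖ] H) (hJ_adj : J = -adjoint J) (hJ_sq : J * J = -1)
    (hJ_polar : A - adjoint A = J * absOp (A - adjoint A))
    (ι : ℍ[ℝ]) (hι : ‖ι‖ = 1) :
    -- the traces in the identity are well defined
    (∀ M : Set H, IsHilbertBasis M →
      (Summable fun u : M => qinner (u : H) (A u)) ∧
      (nTrace M A).re = realTrace A ∧
      (Summable fun u : M => qinner (u : H) (absOp (A - adjoint A) u)) ∧
      nTrace M (absOp (A - adjoint A)) = trace (absOp (A - adjoint A))) ∧
    -- the identity for Hilbert bases in the slice of `J`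
    (∀ N : Set H, IsHilbertBasis N → N ⊆ slice J ι →
      nTrace N A = (realTrace A : ℍ[ℝ]) + ι / 2 * trace (absOp (A - adjoint A))) ∧
    -- the identity for every `J'` that agrees with `J` on the complement of the kernel
    (∀ J' : H →L[ℍ[ℝ]ᵐᵒᵖ] H,
      (∀ x ∈ orthogonalComplement {y : H | (A - adjoint A) y = 0}, J x = J' x) →
      ∀ N' : Set H, IsHilbertBasis N' → N' ⊆ slice J' ι →
        nTrace N' A = (realTrace A : ℍ[ℝ]) + ι / 2 * trace (absOp (A - adjoint A))) := by
  obtain ⟨r, hr⟩ := hA.exists_hasRealTrace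
  obtain ⟨s, hs⟩ := hA.exists_hasRealTrace_absOp_sub_adjoint hJ_sq hJ_polar
  refine ⟨fun M hM => ⟨(hr M hM).1, hr.re_nTrace hM, (hs M hM).1,
    hs.nTrace_eq_trace (absOp_spec _).2.1 hM⟩, fun N hN hNJ => ?_, fun J' hJ' N hN hNJ => ?_⟩
  · exact nTrace_eq_of_subset_slice hA hJ_sq hJ_polar (fun _ _ => rfl) hN hNJ
  · exact nTrace_eq_of_subset_slice hA hJ_sq hJ_polar hJ' hN hNJ
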